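/- Let $\mathcal B\subseteq\mathbb R^3$ be a body, i.e. a three-dimensional manifold covered by one chart, identified with an open subset of $\mathbb R^3$ through a reference configuration. Let $W: Gl(3,\mathbb R)\times\mathcal B\to V$ be its smooth response functional, with values in a real vector space $V$, regarded as a function of $1$-jets by $W(j^1_{x,y}\phi)=W(d\phi_{|x},x)$. For open $U,U'\subseteq\mathcal B$ let $\Pi^1(U,U')$ be the set of invertible $1$-jets $j^1_{x,y}\psi$ with $x\in U$, $y\in U'$. A deformation of $\mathcal B$ is a smooth embedding $\kappa:\mathcal B\to\mathbb R^3$. The material groupoid $\Omega(\mathcal B)\subseteq\Pi^1(\mathcal B,\mathcal B)$ consists of the jets $j^1_{x,y}\psi$ with $W(j^1_{y,\kappa(y)}\kappa\cdot j^1_{x,y}\psi)=W(j^1_{y,\kappa(y)}\kappa)$ for all deformations $\kappa$; it is assumed to be a Lie subgroupoid of $\Pi^1(\mathcal B,\mathcal B)$. Assume that $\mathcal B$ is uniform: for all $x,y\in\mathcal B$ there is a local diffeomorphism $\psi$ of $\mathcal B$ with $\psi(x)=y$ and $j^1_{x,y}\psi\in\Omega(\mathcal B)$. Write $\tau_v$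 for the translation by $v$. Call $\mathcal B$ homogeneous if there is a deformation $\kappa$ of $\mathcal B$ with $j^1_{x,y}(\kappa^{-1}\circ\tau_{\kappa(y)-\kappa(x)}\circ\kappa)\in\Omega(\mathcal B)$ for all $x,y\in\mathcal B$, and locally homogeneous if it is covered by open subsets that are homogeneous (as bodies with the restricted response). Call $\Omega(\mathcal B)$ integrable if there is a Lie subgroup $G$ of $Gl(3,\mathbb R)$ such that for all $x,y\in\mathcal B$ there are charts $\psi_U:U\to\overline U\subseteq\mathbb R^3$ and $\psi_{U'}:U'\to\overline{U'}\subseteq\mathbb R^3$ of $\mathcal B$ with $x\in U$, $y\in U'$ for which $$j^1_{a,b}\phi\ \longmapsto\ \bigl(\psi_U(a),\ \psi_{U'}(b),\ j^1_{0,0}(\tau_{-\psi_{U'}(b)}\circ\psi_{U'}\circ\phi\circ\psi_U^{-1}\circ\tau_{\psi_U(a)})\bigr)$$ is a diffeomorphism from $\Omega(\mathcal B)\cap\Pi^1(U,U')$ onto $\overline U\times\overline{U'}\times G$. If $\mathcal B$ is homogeneous, then $\Omega(\mathcal B)$ is integrable. Conversely, if $\Omega(\mathcal B)$ is integrable, then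 $\mathcal B$ is locally homogeneous. -/

import Mathlib

open scoped ContDiff

noncomputable section

/-- Linear endomorphisms of the finite-dimensional real vector space `E` (typically `E = ℝⁿ`). -/
abbrev EndLin (E : Type*) [NormedAddCommGroup E] [NormedSpace ℝ E] : Type _ := E →L[ℝ] E

/-- The group `Gl(E)` of invertible linear endomorphisms; for `E = ℝⁿ` it is `Gl(n, ℝ)`. -/
abbrev GlLin (E : Type*) [NormedAddCommGroup E] [NormedSpace ℝ E] : Type _ := (EndLin E)ˣ

/-- The space of `1`-jets of maps `E → E`, for `E = ℝⁿ`: the jet `j¹_{x,y} φ` is the triple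
`(x, y, dφ|ₓ)` (its standard coordinates). It is a finite-dimensional normed space, so that
smoothness of maps on its subsets has its usual meaning. -/
abbrev Jet (E : Type*) [NormedAddCommGroup E] [NormedSpace ℝ E] : Type _ := E × E × EndLin E

namespace Jet

variable {E : Type*} [NormedAddCommGroup E] [NormedSpace ℝ E]

/-- The source `α (j¹_{x,y} φ) = x`. -/
def src (j : Jet E) : E := j.1

/-- The target `β (j¹_{x,y} φ) = y`. -/
def tgt (j : Jet E) : E := j.2.1

/-- The linear part `dφ|ₓ` of `j¹_{x,y} φ`. -/
def lin (j : Jet E) : EndLin E := j.2.2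

/-- The `1`-jet of the map `φ` at the point `x`. -/
def of (φ : E → E) (x : E) : Jet E := (x, φ x, fderiv ℝ φ x)

/-- Composition of jets; `comp k j` is the jet `k · j`, and is meaningful when `tgt j = src k`. -/
def comp (k j : Jet E) : Jet E := (j.src, k.tgt, k.lin * j.lin)

/-- The identity jet `j¹_{x,x} Id`. -/
def ident (x : E) : Jet E := (x, x, 1)

/-- The inverse jet `j¹_{y,x} φ⁻¹` of an invertible jet `j¹_{x,y} φ`. -/
def inv (j : Jet E) : Jet E := (j.tgt, j.src, Ring.inverse j.lin)

/-- `Π¹(U, V)`: the invertible jets with source in `U` and target in `V`.  For an open set `M`,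
`Π¹(M, M)` is the `1`-jets groupoid of `M`. -/
def invertible (U V : Set E) : Set (Jet E) :=
  {j | j.src ∈ U ∧ j.tgt ∈ V ∧ IsUnit j.lin}

end Jet

section Manifolds

variable {E F : Type*} [NormedAddCommGroup E] [NormedSpace ℝ E]
    [NormedAddCommGroup F] [NormedSpace ℝ F]

/-- A homeomorphism between open subsets of two normed spaces is a diffeomorphism
(of class `C^∞`, with inverse of class `C^∞`). -/
structure IsLocalDiffeo (φ : OpenPartialHomeomorph E F) : Prop where
  smooth : ContDiffOn ℝ ∞ φ φ.source
  smooth_symm : ContDiffOn ℝ ∞ φ.symm φ.target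

/-- `S` is an (embedded) smooth submanifold of the finite-dimensional space `E`: around each of its
points there is a smooth chart of `E` that flattens `S` to a linear subspace. -/
def IsSubmanifold (S : Set E) : Prop :=
  ∀ p ∈ S, ∃ φ : OpenPartialHomeomorph E E, IsLocalDiffeo φ ∧ p ∈ φ.source ∧
    ∃ L : Submodule ℝ E, ∀ q ∈ φ.source, q ∈ S ↔ φ q ∈ L

/-- The tangent vectors to `S` at `p`: the velocities at `p` of smooth curves in `S`. -/
def tangentVectors (S : Set E) (p : E) :
    Set E :=
  {v | ∃ γ : ℝ → E, ContDiffAt ℝ ∞ γ 0 ∧ γ 0 = p ∧ (∀ᶠ t in nhds 0, γ t ∈ S) ∧ deriv γ 0 = v}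

/-- `f` restricts to a diffeomorphism from `S` onto `T` (to be used for embedded submanifolds
`S`, `T`): it is a bijection of `S` onto `T`, it is smooth on `S` and its inverse is smooth
on `T`. -/
def IsDiffeoBetween (f : E → F) (S : Set E) (T : Set F) : Prop :=
  Set.BijOn f S T ∧ ContDiffOn ℝ ∞ f S ∧
    ∃ g : F → E, Set.InvOn g f S T ∧ ContDiffOn ℝ ∞ g T

/-- The subset of the space of endomorphisms underlying a subgroup of `Gl(E)`. -/
def linSet (G : Subgroup (GlLin E)) : Set (EndLin E) :=
  {A | ∃ g ∈ G, (g : EndLin E) = A}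

/-- `G` is a Lie subgroup of `Gl(E)`: a subgroup that is a submanifold. -/
def IsLieSubgroup (G : Subgroup (GlLin E)) : Prop :=
  IsSubmanifold (linSet G)

/-- `S` is a Lie subgroupoid over `M` of the `1`-jets groupoid `Π¹(M, M)`: a subgroupoid that
contains all the identities, is a submanifold, and whose source and target maps are
submersions onto `M`. (The other structure maps are restrictions of smooth maps.) -/
structure IsLieSubgroupoid (M : Set E) (S : Set (Jet E)) : Prop where
  subset : S ⊆ Jet.invertible M M
  ident_mem : ∀ x ∈ M, Jet.ident x ∈ S
  comp_mem : ∀ k ∈ S, ∀ j ∈ S, j.tgt = k.src → Jet.comp k j ∈ S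
  inv_mem : ∀ j ∈ S, Jet.inv j ∈ S
  submanifold : IsSubmanifold S
  submersion_src : ∀ j ∈ S, ∀ u : E, ∃ v ∈ tangentVectors S j, Jet.src v = u
  submersion_tgt : ∀ j ∈ S, ∀ u : E, ∃ v ∈ tangentVectors S j, Jet.tgt v = u

/-- The map `Ψ_{U,V}` induced on jets from `U` to `V` by the charts `ψU` and `ψV`: the jet
`j = j¹_{x,y} φ` is sent to `(ψU x, ψV y, A)` with `A` the linear part of
`j¹_{0,0} (τ_{-ψV y} ∘ ψV ∘ φ ∘ ψU⁻¹ ∘ τ_{ψU x})`. -/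
def chartMap (ψU ψV : OpenPartialHomeomorph E E) (j : Jet E) :
    E × E × EndLin E :=
  (ψU j.src, ψV j.tgt,
    (Jet.comp (Jet.of (fun v => ψV v - ψV j.tgt) j.tgt)
      (Jet.comp j (Jet.of (fun v => ψU.symm (v + ψU j.src)) 0))).lin)

/-- The subgroupoid `S` of `Π¹(M, M)` is integrable: it is locally diffeomorphic to
`E × E × G` (with `E = ℝⁿ`) for some Lie subgroup `G` of `Gl(E)`. -/
def IsIntegrableGroupoid (M : Set E) (S : Set (Jet E)) : Prop :=
  ∃ G : Subgroup (GlLin E), IsLieSubgroup G ∧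
    ∀ x ∈ M, ∀ y ∈ M, ∃ ψU ψV : OpenPartialHomeomorph E E,
      IsLocalDiffeo ψU ∧ IsLocalDiffeo ψV ∧
      x ∈ ψU.source ∧ ψU.source ⊆ M ∧ y ∈ ψV.source ∧ ψV.source ⊆ M ∧
      IsDiffeoBetween (chartMap ψU ψV) (S ∩ Jet.invertible ψU.source ψV.source)
        (ψU.target ×ˢ ψV.target ×ˢ linSet G)

end Manifolds

/-- The Euclidean space `ℝⁿ`. -/
abbrev Rn (n : ℕ) : Type := EuclideanSpace ℝ (Fin n)

/-- A (simple, elastic) body, identified with an open subset of `ℝ³` through a reference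
configuration, with its smooth response function `W : Gl(3, ℝ) × B → V`. Only the values of `W` on
`Gl(3, ℝ) × B` matter. -/
structure Body (V : Type*) [NormedAddCommGroup V] [NormedSpace ℝ V] where
  carrier : Set (Rn 3)
  isOpen_carrier : IsOpen carrier
  response : EndLin (Rn 3) → Rn 3 → V
  smooth_response : ContDiffOn ℝ ∞ (fun p : EndLin (Rn 3) × Rn 3 => response p.1 p.2)
    ({A | IsUnit A} ×ˢ carrier)

namespace Body

variable {V : Type*} [NormedAddCommGroup V] [NormedSpace ℝ V]

/-- The response functional on jets, `W (j¹_{x,y} φ) = W (dφ|ₓ, x)`; it does not depend on the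
final point `y`. -/
def W (B : Body V) (j : Jet (Rn 3)) : V := B.response j.lin j.src

/-- A (global) deformation of the body: an embedding `κ : B → ℝ³`, that is, a diffeomorphism from
the open set `B` onto an open subset of `ℝ³`. Its jets `Jet.of κ y`, for `y ∈ B`, are
the infinitesimal deformations. -/
def IsDeformation (B : Body V) (κ : OpenPartialHomeomorph (Rn 3) (Rn 3)) : Prop :=
  IsLocalDiffeo κ ∧ κ.source = B.carrier

/-- The jet `j = j¹_{x,y} ψ` leaves the response unchanged:
`W (j¹_{y,κ y} κ · j¹_{x,y} ψ) = W (j¹_{y,κ y} κ)` for all infinitesimal deformations at `y`. -/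
def PreservesResponse (B : Body V) (j : Jet (Rn 3)) : Prop :=
  ∀ κ : OpenPartialHomeomorph (Rn 3) (Rn 3), B.IsDeformation κ →
    B.W (Jet.comp (Jet.of κ j.tgt) j) = B.W (Jet.of κ j.tgt)

/-- The material groupoid `Ω(B)`. -/
def materialGroupoid (B : Body V) : Set (Jet (Rn 3)) :=
  {j | j ∈ Jet.invertible B.carrier B.carrier ∧ B.PreservesResponse j}

/-- The body is uniform: any two points `x`, `y` are connected by a local diffeomorphism of the body
that takes `x` to `y` and whose jet at `x` leaves the response unchanged. -/
def IsUniform (B : Body V) : Prop :=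
  ∀ x ∈ B.carrier, ∀ y ∈ B.carrier, ∃ ψ : OpenPartialHomeomorph (Rn 3) (Rn 3),
    IsLocalDiffeo ψ ∧ x ∈ ψ.source ∧ ψ.source ⊆ B.carrier ∧ ψ.target ⊆ B.carrier ∧
    ψ x = y ∧ B.PreservesResponse (Jet.of ψ x)

/-- The body is homogeneous: there is a global deformation `κ` such that the jets
`j¹_{x,y} (κ⁻¹ ∘ τ_{κ y - κ x} ∘ κ)` belong to the material groupoid, for all `x`, `y`. -/
def IsHomogeneous (B : Body V) : Prop :=
  ∃ κ : OpenPartialHomeomorph (Rn 3) (Rn 3), B.IsDeformation κ ∧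
    ∀ x ∈ B.carrier, ∀ y ∈ B.carrier,
      Jet.of (fun v => κ.symm (κ v + (κ y - κ x))) x ∈ B.materialGroupoid

/-- The sub-body given by an open subset `U` of the body, with the restricted response. -/
def restrict (B : Body V) (U : Set (Rn 3)) (hU : IsOpen U) (hUB : U ⊆ B.carrier) : Body V where
  carrier := U
  isOpen_carrier := hU
  response := B.response
  smooth_response := B.smooth_response.mono (Set.prod_mono subset_rfl hUB)

/-- The body is locally homogeneous: it is covered by homogeneous open subsets. -/
def IsLocallyHomogeneous (B : Body V) : Prop :=
  ∀ x ∈ B.carrier, ∃ (U : Set (Rn 3)) (hU : IsOpen U) (hUB : U ⊆ B.carrier),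
    x ∈ U ∧ (B.restrict U hU hUB).IsHomogeneous

end Body

end

/-! Every element of `Gl(3, ℝ)` is the derivative of a deformation, so a jet `(x, y, A)` with `A`
invertible lies in `Ω(B)` exactly when `W(P A, x) = W(P, y)` for all invertible `P`
(`mem_materialGroupoid`).

If `κ` makes `B` homogeneous, then `Q ↦ W(Q dκ_x, x)` is the same function for every `x`
(`response_mul_fderiv_eq`). Let `G` be the group of right translations that leave it invariant. A
jet lies in `Ω(B)` iff its linear part read in `κ` lies in `G` (`mem_materialGroupoid_iff_linSet`),
so `κ`, used at both ends, trivialises `Ω(B)`. That `G` is a submanifold follows by pulling `Ω(B)`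
back along an affine map transverse to it (`IsSubmanifold.preimage`, `isLieSubgroup_isotropy`).

Conversely, let `φ`, `ψ` trivialise `Ω(B)` near `(x, x)`. The identity jet at `b` puts the
transition `dψ_b (dφ_b)⁻¹` in `G`; surjectivity over `(φ a, ψ b)` then puts the jet with linear part
`(dφ_b)⁻¹ dφ_a` in `Ω(B)`. This is the jet of a translation in the chart `φ`. -/

namespace IsLocalDiffeo

variable {E F : Type*} [NormedAddCommGroup E] [NormedSpace ℝ E]
    [NormedAddCommGroup F] [NormedSpace ℝ F] {φ : OpenPartialHomeomorph E F}

theorem symm (hφ : IsLocalDiffeo φ) : IsLocalDiffeo φ.symm :=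
  ⟨hφ.smooth_symm, hφ.smooth⟩

theorem restrOpen (hφ : IsLocalDiffeo φ) {U : Set E} (hU : IsOpen U) :
    IsLocalDiffeo (φ.restrOpen U hU) := by
  refine ⟨hφ.smooth.mono ?_, hφ.smooth_symm.mono ?_⟩
  · exact Set.inter_subset_left
  · exact fun x hx => hx.1

theorem contDiffAt (hφ : IsLocalDiffeo φ) {x : E} (hx : x ∈ φ.source) : ContDiffAt ℝ ∞ φ x :=
  hφ.smooth.contDiffAt (φ.open_source.mem_nhds hx)

theorem hasFDerivAt (hφ : IsLocalDiffeo φ) {x : E} (hx : x ∈ φ.source) :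
    HasFDerivAt φ (fderiv ℝ φ x) x :=
  ((hφ.contDiffAt hx).differentiableAt (by simp)).hasFDerivAt

theorem hasFDerivAt_symm (hφ : IsLocalDiffeo φ) {x : E} (hx : x ∈ φ.source) :
    HasFDerivAt φ.symm (fderiv ℝ φ.symm (φ x)) (φ x) :=
  hφ.symm.hasFDerivAt (φ.map_source hx)

theorem fderiv_symm_comp (hφ : IsLocalDiffeo φ) {x : E} (hx : x ∈ φ.source) :
    (fderiv ℝ φ.symm (φ x)).comp (fderiv ℝ φ x) = ContinuousLinearMap.id ℝ E :=
  ((hφ.hasFDerivAt_symm hx).comp x (hφ.hasFDerivAt hx)).unique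
    ((hasFDerivAt_id x).congr_of_eventuallyEq (φ.eventually_left_inverse hx))

theorem fderiv_comp_symm (hφ : IsLocalDiffeo φ) {x : E} (hx : x ∈ φ.source) :
    (fderiv ℝ φ x).comp (fderiv ℝ φ.symm (φ x)) = ContinuousLinearMap.id ℝ F := by
  have h := hφ.symm.fderiv_symm_comp (φ.map_source hx)
  simpa [φ.left_inv hx] using h

end IsLocalDiffeo

/-! ### Inverse function theorem and transverse preimages -/

section Submanifolds

variable {E F : Type*} [NormedAddCommGroup E] [NormedSpace ℝ E]
    [NormedAddCommGroup F] [NormedSpace ℝ F]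

/-- The inverse function theorem for smooth maps. -/
theorem exists_isLocalDiffeo_of_hasFDerivAt [CompleteSpace E] {f : E → F} {O : Set E}
    (hO : IsOpen O) (hf : ContDiffOn ℝ ∞ f O) {p : E} (hp : p ∈ O) (e : E ≃L[ℝ] F)
    (he : HasFDerivAt f (e : E →L[ℝ] F) p) :
    ∃ ψ : OpenPartialHomeomorph E F,
      IsLocalDiffeo ψ ∧ p ∈ ψ.source ∧ ψ.source ⊆ O ∧ ∀ x, ψ x = f x := by
  have hat : ∀ x ∈ O, ContDiffAt ℝ ∞ f x := fun x hx => hf.contDiffAt (hO.mem_nhds hx)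
  -- Restricting to the points with invertible derivative makes the inverse smooth on the whole
  -- target, not only near `f p`.
  have hO' : IsOpen (O ∩ fderiv ℝ f ⁻¹'
      Set.range (ContinuousLinearEquiv.toContinuousLinearMap : (E ≃L[ℝ] F) → E →L[ℝ] F)) :=
    (hf.continuousOn_fderiv_of_isOpen hO (by simp)).isOpen_inter_preimage hO
      ContinuousLinearEquiv.isOpen
  let χ := (hat p hp).toOpenPartialHomeomorph f he (by simp)
  have hχ : ∀ x, χ x = f x := fun x =>
    congrFun ((hat p hp).toOpenPartialHomeomorph_coe he (by simp)) x
  refine ⟨χ.restrOpen _ hO', ⟨?_, ?_⟩, ?_, ?_, hχ⟩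
  · exact (hf.mono fun x hx => hx.2.1).congr fun x _ => hχ x
  · intro y hy
    obtain ⟨hyt, hyO, e', he'⟩ := hy
    have hx : ContDiffAt ℝ ∞ f (χ.symm y) := hat _ hyO
    have hfun : (χ : E → F) = f := funext hχ
    have hd : HasFDerivAt χ (e' : E →L[ℝ] F) (χ.symm y) := by
      rw [hfun, he']
      exact (hx.differentiableAt (by simp)).hasFDerivAt
    exact (χ.contDiffAt_symm hyt hd (by rw [hfun]; exact hx)).contDiffWithinAt
  · exact ⟨(hat p hp).mem_toOpenPartialHomeomorph_source he (by simp), hp, e, he.fderiv.symm⟩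
  · exact fun x hx => hx.2.1

/-- If `f` vanishes on `S` near `p`, its derivative at `p` kills the tangent vectors to `S` at `p`. -/
theorem apply_eq_zero_of_mem_tangentVectors {S : Set E} {p v : E} (hv : v ∈ tangentVectors S p)
    {f : E → F} {f' : E →L[ℝ] F} (hf : HasFDerivAt f f' p)
    (hS : ∀ᶠ x in nhds p, x ∈ S → f x = 0) : f' v = 0 := by
  obtain ⟨γ, hγ, h0, hmem, rfl⟩ := hv
  have hd : HasDerivAt γ (deriv γ 0) 0 := (hγ.differentiableAt (by simp)).hasDerivAt
  subst h0
  have h1 : HasDerivAt (f ∘ γ) (f' (deriv γ 0)) 0 := hf.comp_hasDerivAt 0 hd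
  have h2 : f ∘ γ =ᶠ[nhds 0] fun _ => 0 := by
    filter_upwards [hmem, hd.continuousAt.eventually hS] with t ht h using h ht
  exact h1.unique ((hasDerivAt_const (0 : ℝ) (0 : F)).congr_of_eventuallyEq h2)

/-- The preimage of a submanifold under a map transverse to it is a submanifold. -/
theorem IsSubmanifold.preimage [FiniteDimensional ℝ E] [FiniteDimensional ℝ F] {S : Set F}
    (hS : IsSubmanifold S) {h : E → F} (hh : ContDiff ℝ ∞ h)
    (htr : ∀ p, h p ∈ S → ∀ w, ∃ u, w - fderiv ℝ h p u ∈ tangentVectors S (h p)) :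
    IsSubmanifold (h ⁻¹' S) := by
  intro p hp
  have : CompleteSpace E := FiniteDimensional.complete ℝ E
  obtain ⟨φ, hφ, hpφ, L, hL⟩ := hS (h p) hp
  -- Projecting along `L` onto a complement turns the flattening chart into a local equation `π ∘ φ
  -- = 0` of `S`.
  obtain ⟨L', hc⟩ := L.exists_isCompl
  let π : F →L[ℝ] L' := LinearMap.toContinuousLinearMap (L'.projectionOnto L hc.symm)
  have hπ : ∀ x, π x = 0 ↔ x ∈ L := fun x => L'.projectionOnto_apply_eq_zero_iff hc.symm
  let T₀ : F →L[ℝ] L' := π.comp (fderiv ℝ φ (h p))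
  let T : E →L[ℝ] L' := T₀.comp (fderiv ℝ h p)
  have hT₀ : HasFDerivAt (fun x => π (φ x)) T₀ (h p) :=
    π.hasFDerivAt.comp (h p) (hφ.hasFDerivAt hpφ)
  have hhd : HasFDerivAt h (fderiv ℝ h p) p :=
    (hh.differentiable (by simp) p).hasFDerivAt
  have hq : HasFDerivAt (fun x => π (φ (h x))) T p := hT₀.comp p hhd
  have hsurj : Function.Surjective T := by
    intro w
    -- Lift `w` through `φ` and correct by transversality: `T₀` kills the tangent remainder, so `T u
    -- = w`.
    obtain ⟨u, hu⟩ := htr p hp (fderiv ℝ φ.symm (φ (h p)) w)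
    refine ⟨u, ?_⟩
    have h1 := apply_eq_zero_of_mem_tangentVectors hu hT₀ (by
      filter_upwards [φ.open_source.mem_nhds hpφ] with x hx hxS
      exact (hπ _).2 ((hL x hx).1 hxS))
    have h2 : fderiv ℝ φ (h p) (fderiv ℝ φ.symm (φ (h p)) w) = w :=
      DFunLike.congr_fun (hφ.fderiv_comp_symm hpφ) (w : F)
    have h3 : π (w : F) = w := L'.projectionOnto_apply_left hc.symm w
    rw [map_sub, sub_eq_zero] at h1
    change T₀ (fderiv ℝ h p u) = w
    rw [← h1]
    change π (fderiv ℝ φ (h p) (fderiv ℝ φ.symm (φ (h p)) w)) = w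
    rw [h2, h3]
  obtain ⟨r₀, hr₀⟩ := T.toLinearMap.exists_rightInverse_of_surjective
    (LinearMap.range_eq_top.2 hsurj)
  have : FiniteDimensional ℝ L' := inferInstance
  let r : L' →L[ℝ] E := LinearMap.toContinuousLinearMap r₀
  have hr : ∀ y, T (r y) = y := fun y => DFunLike.congr_fun hr₀ y
  have hO : IsOpen (h ⁻¹' φ.source) := φ.open_source.preimage hh.continuous
  -- With `r` a right inverse of `T`, this map has derivative the identity at `p`, and `T` carries
  -- it to `π ∘ φ ∘ h`. As a chart it therefore flattens the preimage to `ker T`.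
  have hsm : ContDiffOn ℝ ∞ (fun x => r (π (φ (h x))) + (x - r (T x))) (h ⁻¹' φ.source) := by
    have h1 : ContDiffOn ℝ ∞ (fun x => φ (h x)) (h ⁻¹' φ.source) :=
      hφ.smooth.comp hh.contDiffOn fun x hx => hx
    exact (r.contDiff.comp_contDiffOn (π.contDiff.comp_contDiffOn h1)).add
      (contDiff_id.sub (r.contDiff.comp T.contDiff)).contDiffOn
  have hd : HasFDerivAt (fun x => r (π (φ (h x))) + (x - r (T x)))
      ((ContinuousLinearEquiv.refl ℝ E : E ≃L[ℝ] E) : E →L[ℝ] E) p := by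
    have h1 := (r.hasFDerivAt.comp p hq).add
      ((hasFDerivAt_id p).sub (r.hasFDerivAt.comp p T.hasFDerivAt))
    refine h1.congr_fderiv ?_
    ext x
    simp
  obtain ⟨ψ, hψ, hpψ, hsub, hψf⟩ := exists_isLocalDiffeo_of_hasFDerivAt hO hsm hpφ _ hd
  refine ⟨ψ, hψ, hpψ, LinearMap.ker T.toLinearMap, fun x hx => ?_⟩
  have h1 : T (ψ x) = π (φ (h x)) := by
    rw [hψf, map_add, map_sub, hr, hr]
    abel
  rw [Set.mem_preimage, hL _ (hsub hx), ← hπ, ← h1]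
  rfl

theorem IsOpen.isSubmanifold {S : Set E} (hS : IsOpen S) : IsSubmanifold S := fun _ hp =>
  ⟨OpenPartialHomeomorph.ofSet S hS, ⟨contDiffOn_id, contDiffOn_id⟩, hp, ⊤,
    fun _ hq => ⟨fun _ => Submodule.mem_top, fun _ => hq⟩⟩

end Submanifolds

/-! ### Jets read in charts -/

section Jets

variable {E : Type*} [NormedAddCommGroup E] [NormedSpace ℝ E]

theorem IsLocalDiffeo.fderiv_symm_mul {φ : OpenPartialHomeomorph E E} (hφ : IsLocalDiffeo φ)
    {x : E} (hx : x ∈ φ.source) : fderiv ℝ φ.symm (φ x) * fderiv ℝ φ x = 1 :=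
  hφ.fderiv_symm_comp hx

theorem IsLocalDiffeo.fderiv_mul_symm {φ : OpenPartialHomeomorph E E} (hφ : IsLocalDiffeo φ)
    {x : E} (hx : x ∈ φ.source) : fderiv ℝ φ x * fderiv ℝ φ.symm (φ x) = 1 :=
  hφ.fderiv_comp_symm hx

/-- The derivative of a local diffeomorphism as an element of `Gl(E)`. -/
noncomputable def IsLocalDiffeo.fderivUnit {φ : OpenPartialHomeomorph E E} (hφ : IsLocalDiffeo φ)
    {x : E} (hx : x ∈ φ.source) : GlLin E :=
  ⟨fderiv ℝ φ x, fderiv ℝ φ.symm (φ x), hφ.fderiv_mul_symm hx, hφ.fderiv_symm_mul hx⟩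

theorem chartMap_eq (ψU ψV : OpenPartialHomeomorph E E) (j : Jet E) :
    chartMap ψU ψV j = (ψU j.1, ψV j.2.1,
      fderiv ℝ ψV j.2.1 * (j.2.2 * fderiv ℝ ψU.symm (ψU j.1))) := by
  simp [chartMap, Jet.comp, Jet.of, Jet.lin, Jet.src, Jet.tgt, fderiv_sub_const,
    fderiv_comp_add_right]

theorem IsLocalDiffeo.jet_of_translation {κ : OpenPartialHomeomorph E E} (hκ : IsLocalDiffeo κ)
    {x y : E} (hx : x ∈ κ.source) (hy : y ∈ κ.source) :
    Jet.of (fun v => κ.symm (κ v + (κ y - κ x))) x =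
      (x, y, fderiv ℝ κ.symm (κ y) * fderiv ℝ κ x) := by
  have h1 : HasFDerivAt (fun v => κ v + (κ y - κ x)) (fderiv ℝ κ x) x :=
    (hκ.hasFDerivAt hx).add_const _
  have h2 : HasFDerivAt κ.symm (fderiv ℝ κ.symm (κ y)) (κ x + (κ y - κ x)) := by
    rw [add_sub_cancel]
    exact hκ.hasFDerivAt_symm hy
  have h3 := (h2.comp x h1).fderiv
  simp only [Function.comp_def] at h3
  simp only [Jet.of, h3, add_sub_cancel, κ.left_inv hy]
  rfl

end Jets

section Jets

variable {E : Type*} [NormedAddCommGroup E] [NormedSpace ℝ E]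

theorem chartMap_symm_chartMap {φ ψ : OpenPartialHomeomorph E E} (hφ : IsLocalDiffeo φ)
    (hψ : IsLocalDiffeo ψ) {j : Jet E} (h1 : j.1 ∈ φ.source) (h2 : j.2.1 ∈ ψ.source) :
    chartMap φ.symm ψ.symm (chartMap φ ψ j) = j := by
  obtain ⟨x, y, A⟩ := j
  simp only at h1 h2
  simp only [chartMap_eq, φ.symm_symm, φ.left_inv h1, ψ.left_inv h2]
  rw [mul_assoc, mul_assoc, hφ.fderiv_symm_mul h1, mul_one, ← mul_assoc, hψ.fderiv_symm_mul h2,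
    one_mul]

theorem chartMap_chartMap_symm {φ ψ : OpenPartialHomeomorph E E} (hφ : IsLocalDiffeo φ)
    (hψ : IsLocalDiffeo ψ) {j : Jet E} (h1 : j.1 ∈ φ.target) (h2 : j.2.1 ∈ ψ.target) :
    chartMap φ ψ (chartMap φ.symm ψ.symm j) = j :=
  chartMap_symm_chartMap hφ.symm hψ.symm h1 h2

theorem contDiffOn_chartMap {φ ψ : OpenPartialHomeomorph E E} (hφ : IsLocalDiffeo φ)
    (hψ : IsLocalDiffeo ψ) :
    ContDiffOn ℝ ∞ (chartMap φ ψ) (φ.source ×ˢ ψ.source ×ˢ Set.univ) := by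
  have h1 : ContDiffOn ℝ ∞ (fun j : Jet E => φ j.1) (φ.source ×ˢ ψ.source ×ˢ Set.univ) :=
    hφ.smooth.comp contDiff_fst.contDiffOn fun j hj => hj.1
  have h2 : ContDiffOn ℝ ∞ (fun j : Jet E => ψ j.2.1) (φ.source ×ˢ ψ.source ×ˢ Set.univ) :=
    hψ.smooth.comp (contDiff_fst.comp contDiff_snd).contDiffOn fun j hj => hj.2.1
  have h3 : ContDiffOn ℝ ∞ (fun j : Jet E => fderiv ℝ ψ j.2.1)
      (φ.source ×ˢ ψ.source ×ˢ Set.univ) :=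
    (hψ.smooth.fderiv_of_isOpen ψ.open_source (by simp)).comp
      (contDiff_fst.comp contDiff_snd).contDiffOn fun j hj => hj.2.1
  have h4 : ContDiffOn ℝ ∞ (fun j : Jet E => fderiv ℝ φ.symm (φ j.1))
      (φ.source ×ˢ ψ.source ×ˢ Set.univ) :=
    (hφ.smooth_symm.fderiv_of_isOpen φ.open_target (by simp)).comp h1
      fun j hj => φ.map_source hj.1
  have h5 : ContDiffOn ℝ ∞ (fun j : Jet E => j.2.2) (φ.source ×ˢ ψ.source ×ˢ Set.univ) :=
    (contDiff_snd.comp contDiff_snd).contDiffOn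
  exact (h1.prodMk (h2.prodMk (h3.clm_comp (h5.clm_comp h4)))).congr fun j _ => chartMap_eq φ ψ j

/-- A set of invertible jets that corresponds to `linSet G` in the charts `φ`, `ψ` is
diffeomorphic to the product of the images of the charts with `G`. -/
theorem isDiffeoBetween_chartMap {φ ψ : OpenPartialHomeomorph E E} (hφ : IsLocalDiffeo φ)
    (hψ : IsLocalDiffeo ψ) {S : Set (Jet E)} (hS : S ⊆ φ.source ×ˢ ψ.source ×ˢ Set.univ)
    {G : Set (EndLin E)}
    (hG : ∀ x ∈ φ.source, ∀ y ∈ ψ.source, ∀ A : EndLin E,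
      (x, y, A) ∈ S ↔ fderiv ℝ ψ y * (A * fderiv ℝ φ.symm (φ x)) ∈ G) :
    IsDiffeoBetween (chartMap φ ψ) S (φ.target ×ˢ ψ.target ×ˢ G) := by
  have hinv : Set.InvOn (chartMap φ.symm ψ.symm) (chartMap φ ψ) S
      (φ.target ×ˢ ψ.target ×ˢ G) :=
    ⟨fun j hj => chartMap_symm_chartMap hφ hψ (hS hj).1 (hS hj).2.1,
      fun j hj => chartMap_chartMap_symm hφ hψ hj.1 hj.2.1⟩
  refine ⟨hinv.bijOn ?_ ?_, (contDiffOn_chartMap hφ hψ).mono hS, _, hinv,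
    (contDiffOn_chartMap hφ.symm hψ.symm).mono fun j hj => ⟨hj.1, hj.2.1, Set.mem_univ _⟩⟩
  · intro j hj
    rw [chartMap_eq]
    exact ⟨φ.map_source (hS hj).1, ψ.map_source (hS hj).2.1,
      (hG _ (hS hj).1 _ (hS hj).2.1 _).1 hj⟩
  · intro j hj
    have h1 := φ.map_target hj.1
    have h2 := ψ.map_target hj.2.1
    have h3 : (chartMap φ ψ (chartMap φ.symm ψ.symm j)).2.2 ∈ G := by
      rw [chartMap_chartMap_symm hφ hψ hj.1 hj.2.1]
      exact hj.2.2
    rw [chartMap_eq φ ψ] at h3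
    exact (hG (chartMap φ.symm ψ.symm j).1 h1 (chartMap φ.symm ψ.symm j).2.1 h2 _).2 h3

theorem linSet_top : linSet (⊤ : Subgroup (GlLin E)) = {A | IsUnit A} := by
  ext A
  simp [linSet, IsUnit]

/-- The right translations under which `f` is invariant. -/
def rightStabilizer {Γ V : Type*} [Group Γ] (f : Γ → V) : Subgroup Γ where
  carrier := {g | ∀ Q, f (Q * g) = f Q}
  one_mem' := fun Q => by rw [mul_one]
  mul_mem' := fun {a b} ha hb Q => by rw [← mul_assoc, hb, ha]
  inv_mem' := fun {a} ha Q => by rw [← ha, inv_mul_cancel_right]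

end Jets

/-! ### The material groupoid as a condition on linear parts -/

namespace Body

variable {V : Type*} [NormedAddCommGroup V] [NormedSpace ℝ V] (B : Body V)

/-- The restriction to `B` of a linear automorphism, as a deformation. -/
theorem exists_isDeformation_fderiv_eq (P : GlLin (Rn 3)) :
    ∃ κ : OpenPartialHomeomorph (Rn 3) (Rn 3), B.IsDeformation κ ∧
      ∀ y, fderiv ℝ κ y = (P : EndLin (Rn 3)) := by
  let e := ContinuousLinearEquiv.unitsEquiv ℝ (Rn 3) P
  refine ⟨e.toHomeomorph.toOpenPartialHomeomorph.restrOpen B.carrier B.isOpen_carrier,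
    ⟨IsLocalDiffeo.restrOpen ⟨e.contDiff.contDiffOn, e.symm.contDiff.contDiffOn⟩ _, ?_⟩, ?_⟩
  · exact Set.univ_inter _
  · exact fun y => e.fderiv

theorem IsDeformation.isUnit_fderiv {B : Body V} {κ : OpenPartialHomeomorph (Rn 3) (Rn 3)}
    (hκ : B.IsDeformation κ) {y : Rn 3} (hy : y ∈ B.carrier) : IsUnit (fderiv ℝ κ y) :=
  (hκ.1.fderivUnit (hκ.2 ▸ hy)).isUnit

/-- Only the derivative of a deformation at `y` enters the condition, and restrictions of linear
automorphisms already realise every invertible value. -/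
theorem mem_materialGroupoid {x y : Rn 3} {A : EndLin (Rn 3)} :
    (x, y, A) ∈ B.materialGroupoid ↔ x ∈ B.carrier ∧ y ∈ B.carrier ∧ IsUnit A ∧
      ∀ P : GlLin (Rn 3), B.response (P * A) x = B.response P y := by
  refine ⟨fun ⟨⟨hx, hy, hA⟩, h⟩ => ⟨hx, hy, hA, fun P => ?_⟩,
    fun ⟨hx, hy, hA, h⟩ => ⟨⟨hx, hy, hA⟩, fun κ hκ => ?_⟩⟩
  · obtain ⟨κ, hκ, hP⟩ := B.exists_isDeformation_fderiv_eq P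
    have h1 : B.response (fderiv ℝ κ y * A) x = B.response (fderiv ℝ κ y) y := h κ hκ
    rwa [hP] at h1
  · obtain ⟨P, hP⟩ := hκ.isUnit_fderiv hy
    have h1 := h P
    rw [hP] at h1
    exact h1

/-- Treated apart because there is no base point at which to take the isotropy group. -/
theorem isIntegrableGroupoid_of_isEmpty (h : B.carrier = ∅) :
    IsIntegrableGroupoid B.carrier B.materialGroupoid :=
  ⟨⊤, by rw [IsLieSubgroup, linSet_top]; exact Units.isOpen.isSubmanifold, by simp [h]⟩

/-! ### Homogeneous bodies have integrable material groupoid -/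

section Homogeneous

/-- The material groupoid contains the jets induced by the translations in the chart `κ`. -/
def ContainsTranslations (B : Body V) (κ : OpenPartialHomeomorph (Rn 3) (Rn 3)) : Prop :=
  ∀ x ∈ B.carrier, ∀ y ∈ B.carrier,
    Jet.of (fun v => κ.symm (κ v + (κ y - κ x))) x ∈ B.materialGroupoid

/-- The subgroup of `Gl(3, ℝ)` that corresponds to the isotropy group of `x` in the chart `κ`. -/
noncomputable def isotropy (B : Body V) (κ : OpenPartialHomeomorph (Rn 3) (Rn 3)) (x : Rn 3) :
    Subgroup (GlLin (Rn 3)) :=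
  rightStabilizer fun Q : GlLin (Rn 3) => B.response (Q * fderiv ℝ κ x) x

variable {B} {κ : OpenPartialHomeomorph (Rn 3) (Rn 3)}

/-- The translation jet has linear part `(dκ_y)⁻¹ dκ_x`; testing its invariance on `P = Q dκ_y`
cancels `dκ_y`. Read in `κ`, the response no longer depends on the point. -/
theorem response_mul_fderiv_eq (hκ : B.IsDeformation κ) (hom : B.ContainsTranslations κ)
    {x y : Rn 3} (hx : x ∈ B.carrier) (hy : y ∈ B.carrier)
    (Q : GlLin (Rn 3)) :
    B.response (Q * fderiv ℝ κ x) x = B.response (Q * fderiv ℝ κ y) y := by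
  have hx' : x ∈ κ.source := hκ.2 ▸ hx
  have hy' : y ∈ κ.source := hκ.2 ▸ hy
  have h := hom x hx y hy
  rw [hκ.1.jet_of_translation hx' hy', mem_materialGroupoid] at h
  have h1 := h.2.2.2 (Q * hκ.1.fderivUnit hy')
  have h2 : ((Q * hκ.1.fderivUnit hy' : GlLin (Rn 3)) : EndLin (Rn 3)) =
    Q * fderiv ℝ κ y := rfl
  rw [h2, mul_assoc, ← mul_assoc (fderiv ℝ κ y), hκ.1.fderiv_mul_symm hy', one_mul] at h1
  exact h1

/-- Since the response read in `κ` is the same at `x₀`, `x` and `y`, the substitution `P = Q dκ_y`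
turns invariance under `A` into invariance at `x₀` under right translation by `dκ_y A (dκ_x)⁻¹`. -/
theorem mem_materialGroupoid_iff_linSet (hκ : B.IsDeformation κ) (hom : B.ContainsTranslations κ)
    {x₀ x y : Rn 3} (hx₀ : x₀ ∈ B.carrier) (hx : x ∈ B.carrier) (hy : y ∈ B.carrier) (A : EndLin (Rn 3)) :
    (x, y, A) ∈ B.materialGroupoid ↔
      fderiv ℝ κ y * (A * fderiv ℝ κ.symm (κ x)) ∈ linSet (B.isotropy κ x₀) := by
  have hx' : x ∈ κ.source := hκ.2 ▸ hx
  have hy' : y ∈ κ.source := hκ.2 ▸ hy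
  have e (Q : GlLin (Rn 3)) {z : Rn 3} (hz : z ∈ B.carrier) :
      B.response (Q * fderiv ℝ κ x₀) x₀ = B.response (Q * fderiv ℝ κ z) z :=
    response_mul_fderiv_eq hκ hom hx₀ hz Q
  let X := hκ.1.fderivUnit hx'
  let Y := hκ.1.fderivUnit hy'
  rw [mem_materialGroupoid]
  constructor
  · rintro ⟨-, -, ⟨a, rfl⟩, h⟩
    refine ⟨Y * (a * X⁻¹), fun Q => ?_, rfl⟩
    change B.response (((Q * (Y * (a * X⁻¹)) : GlLin (Rn 3)) : EndLin (Rn 3)) *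
      fderiv ℝ κ x₀) x₀ = B.response (Q * fderiv ℝ κ x₀) x₀
    rw [e _ hx, e _ hy]
    have h1 := h (Q * Y)
    have h2 : ((Q * (Y * (a * X⁻¹)) : GlLin (Rn 3)) : EndLin (Rn 3)) * fderiv ℝ κ x =
        ((Q * (Y * (a * X⁻¹)) * X : GlLin (Rn 3)) : EndLin (Rn 3)) := rfl
    have h3 : Q * (Y * (a * X⁻¹)) * X = Q * Y * a := by group
    rw [h2, h3]
    exact h1
  · rintro ⟨g, hg, hgA⟩
    have hA : A = ((Y⁻¹ * (g * X) : GlLin (Rn 3)) : EndLin (Rn 3)) := by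
      rw [Units.val_mul, Units.val_mul, hgA]
      change A = fderiv ℝ κ.symm (κ y) *
        (fderiv ℝ κ y * (A * fderiv ℝ κ.symm (κ x)) * fderiv ℝ κ x)
      rw [mul_assoc, mul_assoc, hκ.1.fderiv_symm_mul hx', mul_one, ← mul_assoc,
        hκ.1.fderiv_symm_mul hy', one_mul]
    refine ⟨hx, hy, hA ▸ Units.isUnit _, fun P => ?_⟩
    have h1 : B.response (((P * Y⁻¹ * g : GlLin (Rn 3)) : EndLin (Rn 3)) * fderiv ℝ κ x₀) x₀ =
        B.response (((P * Y⁻¹ : GlLin (Rn 3)) : EndLin (Rn 3)) * fderiv ℝ κ x₀) x₀ :=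
      hg (P * Y⁻¹)
    rw [e _ hx, e _ hy] at h1
    have h2 : (P : EndLin (Rn 3)) * A =
        ((P * Y⁻¹ * g : GlLin (Rn 3)) : EndLin (Rn 3)) * fderiv ℝ κ x := by
      rw [hA]
      change ((P * (Y⁻¹ * (g * X)) : GlLin (Rn 3)) : EndLin (Rn 3)) =
        ((P * Y⁻¹ * g * X : GlLin (Rn 3)) : EndLin (Rn 3))
      exact congrArg Units.val (by group)
    have h3 : ((P * Y⁻¹ : GlLin (Rn 3)) : EndLin (Rn 3)) * fderiv ℝ κ y =
        (P : EndLin (Rn 3)) := by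
      change ((P * Y⁻¹ * Y : GlLin (Rn 3)) : EndLin (Rn 3)) = P
      rw [inv_mul_cancel_right]
    rw [h2, h1, h3]

theorem conj_mem_materialGroupoid_iff (hκ : B.IsDeformation κ) (hom : B.ContainsTranslations κ)
    {x₀ x y : Rn 3} (hx₀ : x₀ ∈ B.carrier) (hx : x ∈ B.carrier) (hy : y ∈ B.carrier)
    (A : EndLin (Rn 3)) :
    (x, y, fderiv ℝ κ.symm (κ y) * A * fderiv ℝ κ x) ∈ B.materialGroupoid ↔
      A ∈ linSet (B.isotropy κ x₀) := by
  have hx' : x ∈ κ.source := hκ.2 ▸ hx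
  have hy' : y ∈ κ.source := hκ.2 ▸ hy
  rw [mem_materialGroupoid_iff_linSet hκ hom hx₀ hx hy, mul_assoc, hκ.1.fderiv_mul_symm hx',
    mul_one, ← mul_assoc, hκ.1.fderiv_mul_symm hy', one_mul]

/-- The group is the preimage of `Ω(B)` under `h`, which parametrises jets from `x` to `x` by their
linear part in `κ`. Transversality holds because moving source and target with this linear part
fixed stays in `Ω(B)` and gives every base velocity, while `h` supplies every vertical direction. -/
theorem isLieSubgroup_isotropy (hκ : B.IsDeformation κ) (hom : B.ContainsTranslations κ)
    (hΩ : IsSubmanifold B.materialGroupoid) {x : Rn 3} (hx : x ∈ B.carrier) :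
    IsLieSubgroup (B.isotropy κ x) := by
  have hx' : x ∈ κ.source := hκ.2 ▸ hx
  let ℓ : EndLin (Rn 3) →L[ℝ] Jet (Rn 3) := (0 : EndLin (Rn 3) →L[ℝ] Rn 3).prod
    ((0 : EndLin (Rn 3) →L[ℝ] Rn 3).prod (ContinuousLinearMap.mulLeftRight ℝ (EndLin (Rn 3))
      (fderiv ℝ κ.symm (κ x)) (fderiv ℝ κ x)))
  have hℓ (A : EndLin (Rn 3)) : ℓ A = (0, 0, fderiv ℝ κ.symm (κ x) * A * fderiv ℝ κ x) := rfl
  let h : EndLin (Rn 3) → Jet (Rn 3) := fun A => (x, x, 0) + ℓ A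
  have hh (A : EndLin (Rn 3)) : h A = (x, x, fderiv ℝ κ.symm (κ x) * A * fderiv ℝ κ x) := by
    simp [h, hℓ]
  have hmem (A : EndLin (Rn 3)) : h A ∈ B.materialGroupoid ↔ A ∈ linSet (B.isotropy κ x) := by
    rw [hh, conj_mem_materialGroupoid_iff hκ hom hx hx hx]
  have hpre : linSet (B.isotropy κ x) = h ⁻¹' B.materialGroupoid :=
    Set.ext fun A => (hmem A).symm
  have hfd (A U : EndLin (Rn 3)) : fderiv ℝ h A U = ℓ U := by
    have h1 : HasFDerivAt h ℓ A := ℓ.hasFDerivAt.const_add _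
    rw [h1.fderiv]
  rw [IsLieSubgroup, hpre]
  refine hΩ.preimage (contDiff_const.add ℓ.contDiff) ?_
  rintro A hA ⟨u, v, C⟩
  -- the jets with the same linear part in the chart `κ`, along lines through `x`
  let γ : ℝ → Jet (Rn 3) := fun t => (x + t • u, x + t • v,
    fderiv ℝ κ.symm (κ (x + t • v)) * A * fderiv ℝ κ (x + t • u))
  have hline (w : Rn 3) : ContDiffAt ℝ ∞ (fun t : ℝ => x + t • w) 0 :=
    contDiffAt_const.add (contDiffAt_id.smul contDiffAt_const)
  have hline0 (w : Rn 3) : x + (0 : ℝ) • w = x := by simp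
  have hκx (w : Rn 3) : ContDiffAt ℝ ∞ κ (x + (0 : ℝ) • w) := by
    rw [hline0]
    exact hκ.1.contDiffAt hx'
  have hκs : ContDiffAt ℝ ∞ κ.symm (κ (x + (0 : ℝ) • v)) := by
    rw [hline0]
    exact hκ.1.symm.contDiffAt (κ.map_source hx')
  have h1 : ContDiffAt ℝ ∞ (fun t : ℝ => fderiv ℝ κ (x + t • u)) 0 :=
    ((hκx u).fderiv_right (m := ∞) (by simp)).comp 0 (hline u)
  have h2 : ContDiffAt ℝ ∞ (fun t : ℝ => fderiv ℝ κ.symm (κ (x + t • v))) 0 :=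
    ContDiffAt.comp (0 : ℝ) (hκs.fderiv_right (m := ∞) (by simp)) ((hκx v).comp 0 (hline v))
  have hγ : ContDiffAt ℝ ∞ γ 0 := (hline u).prodMk ((hline v).prodMk
    ((h2.clm_comp contDiffAt_const).clm_comp h1))
  have hd : HasDerivAt γ (deriv γ 0) 0 := (hγ.differentiableAt (by simp)).hasDerivAt
  have hlined (w : Rn 3) : HasDerivAt (fun t : ℝ => x + t • w) w 0 := by
    simpa using ((hasDerivAt_id (0 : ℝ)).smul_const w).const_add x
  have hd1 : (deriv γ 0).1 = u := by
    have h3 := hd.hasFDerivAt.fst.hasDerivAt.unique (hlined u)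
    simpa using h3
  have hd2 : (deriv γ 0).2.1 = v := by
    have h3 := hd.hasFDerivAt.snd.fst.hasDerivAt.unique (hlined v)
    simpa using h3
  -- The velocity of `γ` has base part `(u, v)`. The vertical discrepancy is written in the chart
  -- `κ` so that `ℓ` returns it, leaving exactly `deriv γ 0`.
  refine ⟨fderiv ℝ κ x * (C - (deriv γ 0).2.2) * fderiv ℝ κ.symm (κ x),
    γ, hγ, ?_, ?_, ?_⟩
  · simp only [γ, hline0, hh]
  · have hev (w : Rn 3) : ∀ᶠ t : ℝ in nhds 0, x + t • w ∈ B.carrier :=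
      (hline w).continuousAt.eventually (by
        simp only [hline0]; exact B.isOpen_carrier.mem_nhds hx)
    filter_upwards [hev u, hev v] with t hu hv
    exact (conj_mem_materialGroupoid_iff hκ hom hx hu hv A).2 ((hmem A).1 hA)
  · have h3 : fderiv ℝ κ.symm (κ x) * (fderiv ℝ κ x * (C - (deriv γ 0).2.2) *
        fderiv ℝ κ.symm (κ x)) * fderiv ℝ κ x = C - (deriv γ 0).2.2 := by
      rw [mul_assoc, mul_assoc (fderiv ℝ κ x * _), hκ.1.fderiv_symm_mul hx', mul_one,
        ← mul_assoc, hκ.1.fderiv_symm_mul hx', one_mul]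
    rw [hfd, hℓ, h3]
    refine Prod.ext ?_ (Prod.ext ?_ ?_)
    · simp [hd1]
    · simp [hd2]
    · simp

theorem isIntegrableGroupoid_of_containsTranslations (hκ : B.IsDeformation κ)
    (hom : B.ContainsTranslations κ) (hΩ : IsSubmanifold B.materialGroupoid) :
    IsIntegrableGroupoid B.carrier B.materialGroupoid := by
  obtain h | ⟨x₀, hx₀⟩ := B.carrier.eq_empty_or_nonempty
  · exact B.isIntegrableGroupoid_of_isEmpty h
  refine ⟨B.isotropy κ x₀, isLieSubgroup_isotropy hκ hom hΩ hx₀, fun x hx y hy =>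
    ⟨κ, κ, hκ.1, hκ.1, hκ.2 ▸ hx, hκ.2.subset, hκ.2 ▸ hy, hκ.2.subset,
      isDiffeoBetween_chartMap hκ.1 hκ.1 (fun j hj => ⟨hj.2.1, hj.2.2.1, Set.mem_univ _⟩) ?_⟩⟩
  intro a ha b hb A
  rw [← mem_materialGroupoid_iff_linSet hκ hom hx₀ (hκ.2 ▸ ha) (hκ.2 ▸ hb)]
  exact ⟨fun h => h.1, fun h => ⟨h, ha, hb, h.1.2.2⟩⟩

end Homogeneous

/-! ### Integrability implies local homogeneity -/

theorem ident_mem_materialGroupoid {x : Rn 3} (hx : x ∈ B.carrier) :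
    (x, x, (1 : EndLin (Rn 3))) ∈ B.materialGroupoid :=
  B.mem_materialGroupoid.2 ⟨hx, hx, isUnit_one, fun P => by rw [mul_one]⟩

theorem isLocallyHomogeneous_of_isIntegrableGroupoid
    (h : IsIntegrableGroupoid B.carrier B.materialGroupoid) : B.IsLocallyHomogeneous := by
  obtain ⟨G, -, hG⟩ := h
  intro x hx
  -- Both charts are taken around the same point, so they overlap; `φ` restricted to the overlap
  -- serves as the deformation.
  obtain ⟨φ, ψ, hφ, hψ, hxφ, hφB, hxψ, hψB, hbij, -⟩ := hG x hx x hx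
  refine ⟨φ.source ∩ ψ.source, φ.open_source.inter ψ.open_source,
    fun z hz => hφB hz.1, ⟨hxφ, hxψ⟩, φ.restrOpen ψ.source ψ.open_source,
    ⟨hφ.restrOpen ψ.open_source, rfl⟩, ?_⟩
  intro a ha b hb
  rw [(hφ.restrOpen ψ.open_source).jet_of_translation ha hb]
  change (a, b, fderiv ℝ φ.symm (φ b) * fderiv ℝ φ a) ∈ _
  -- the transition from `φ` to `ψ` at `b` lies in `G`
  have hb' : chartMap φ ψ (b, b, 1) ∈ φ.target ×ˢ ψ.target ×ˢ linSet G :=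
    hbij.mapsTo ⟨B.ident_mem_materialGroupoid (hφB hb.1), hb.1, hb.2, isUnit_one⟩
  rw [chartMap_eq] at hb'
  have hmem : (φ a, ψ b, fderiv ℝ ψ b * fderiv ℝ φ.symm (φ b)) ∈
      φ.target ×ˢ ψ.target ×ˢ linSet G := by
    refine ⟨φ.map_source ha.1, ψ.map_source hb.2, ?_⟩
    simpa only [one_mul] using hb'.2.2
  obtain ⟨j, ⟨hj, hj'⟩, hjG⟩ := hbij.surjOn hmem
  have hjeq : (a, b, fderiv ℝ φ.symm (φ b) * fderiv ℝ φ a) = j := by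
    rw [← chartMap_symm_chartMap hφ hψ hj'.1 hj'.2.1, hjG, chartMap_eq]
    simp only [φ.symm_symm, φ.left_inv ha.1, ψ.left_inv hb.2]
    rw [mul_assoc, ← mul_assoc (fderiv ℝ ψ.symm (ψ b)), hψ.fderiv_symm_mul hb.2, one_mul]
  -- A smaller body may have more deformations, but the linear criterion is the same for both
  -- bodies, so membership passes to the restriction.
  rw [← hjeq, mem_materialGroupoid] at hj
  exact (mem_materialGroupoid _).2 ⟨ha, hb, hj.2.2⟩

end Body

/-- Let `B` be a uniform body whose material groupoid `Ω(B)` is a Lie subgroupoid of `Π¹(B, B)`. If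
`B` is homogeneous, then `Ω(B)` is integrable; conversely, if `Ω(B)` is integrable, then `B` is
locally homogeneous. -/
theorem proposition65 {V : Type*} [NormedAddCommGroup V] [NormedSpace ℝ V] (B : Body V)
    (hΩ : IsLieSubgroupoid B.carrier B.materialGroupoid) (hB : B.IsUniform) :
    (B.IsHomogeneous → IsIntegrableGroupoid B.carrier B.materialGroupoid) ∧
      (IsIntegrableGroupoid B.carrier B.materialGroupoid → B.IsLocallyHomogeneous) := by
  exact
    ⟨fun ⟨_, hκ, hom⟩ => Body.isIntegrableGroupoid_of_containsTranslations hκ hom hΩ.submanifold,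
      B.isLocallyHomogeneous_of_isIntegrableGroupoid⟩
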